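/- **Conventions.** Let $\mathbf{Top}$ be the category of compactly generated weak Hausdorff spaces and continuous maps. A persistent object in a category $\mathcal C$ is a functor $F_\bullet:(\mathbb R,\le)\to\mathcal C$, with transition maps $f_a^b:F_a\to F_b$ for $a\le b$; a persistent space is a persistent object in $\mathbf{Top}$. For a partially ordered set $\mathcal N$, an $\mathcal N$-valued categorical invariant of $\mathcal C$ is an assignment $J:\mathrm{Ob}(\mathcal C)\sqcup\mathrm{Mor}(\mathcal C)\to\mathcal N$ with $J(\mathrm{id}_X)=J(X)$ for every object $X$ and $J(h\circ g\circ f)\le J(g)$ for all composable morphisms $f,g,h$. It assigns to a persistent object $F_\bullet$ the order-reversing map $J(F_\bullet):[a,b]\mapsto J(f_a^b)$ on the closed intervals $[a,b]$, $a\le b$, of $\mathbb R$, ordered by inclusion. For two order-reversing maps $\mathbf J_1,\mathbf J_2$ from these intervals to $\mathcal N$, the erosion distance $d_{\mathrm E}(\mathbf J_1,\mathbf J_2)\in[0,\infty]$ is the infimum of all $\epsilon\ge 0$ such that $\mathbf J_1([a,b])\ge \mathbf J_2([a-\epsilon,b+\epsilon])$ and $\mathbf J_2([a,b])\ge \mathbf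 J_1([a-\epsilon,b+\epsilon])$ for all $a\le b$ (and $\infty$ if there is none). The interleaving distance $d_{\mathrm I}(F_\bullet,G_\bullet)\in[0,\infty]$ is the infimum of all $\epsilon\ge0$ for which there are natural families $\varphi_t:F_t\to G_{t+\epsilon}$ and $\psi_t:G_t\to F_{t+\epsilon}$ ($t\in\mathbb R$) with $\psi_{t+\epsilon}\circ\varphi_t=f_t^{t+2\epsilon}$ and $\varphi_{t+\epsilon}\circ\psi_t=g_t^{t+2\epsilon}$ for all $t$. Two persistent spaces $X_\bullet,Y_\bullet$ are weakly equivalent, $X_\bullet\simeq Y_\bullet$, if there are a persistent space $Z_\bullet$ and natural transformations $X_\bullet\Leftarrow Z_\bullet\Rightarrow Y_\bullet$ all of whose components are weak homotopy equivalences. The homotopy interleaving distance is $$d_{\mathrm{HI}}(X_\bullet,Y_\bullet)=\inf\{d_{\mathrm I}(X'_\bullet,Y'_\bullet)\mid X'_\bullet\simeq X_\bullet,\ Y'_\bullet\simeq Y_\bullet\},$$ with $d_{\mathrm I}$ taken in $\mathbf{Top}$. For a metric space $X$ and $t\in\mathbb R$, $\mathrm{VR}_t(X)$ is the geometric realization (with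 the weak topology) of the simplicial complex of all nonempty finite subsets of $X$ of diameter at most $t$; in particular $\mathrm{VR}_t(X)=\emptyset$ for $t<0$. With the inclusions as transition maps this is a persistent space $\mathrm{VR}_\bullet(X)$. $d_{\mathrm{GH}}$ is the Gromov–Hausdorff distance. **Theorem (Homotopical stability).** Let $\mathcal N$ be a partially ordered set and let $J$ be an $\mathcal N$-valued categorical invariant of $\mathbf{Top}$ such that for any maps $X\xrightarrow{f}Y\xrightarrow{g}Z\xrightarrow{h}W$ in $\mathbf{Top}$ where $g$ is a weak homotopy equivalence, $J(g\circ f)=J(f)$ and $J(h\circ g)=J(h)$. Then for any two persistent spaces $X_\bullet,Y_\bullet:(\mathbb R,\le)\to\mathbf{Top}$, $$d_{\mathrm E}(J(X_\bullet),J(Y_\bullet))\le d_{\mathrm{HI}}(X_\bullet,Y_\bullet).$$ Moreover, for any nonempty compact metric spaces $X$ and $Y$, $$d_{\mathrm E}\bigl(J(\mathrm{VR}_\bullet(X)),J(\mathrm{VR}_\bullet(Y))\bigr)\le 2\cdot d_{\mathrm{GH}}(X,Y).$$ -/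

import Mathlib

open CategoryTheory
open scoped NNReal ENNReal Topology Topology.Homotopy

universe u v w

/-! ### Categorical invariants and the persistent invariants they induce -/

/-- An `N`-valued categorical invariant of a category `C`: a value for every object and every
morphism such that identities have the value of their object and `J (h ∘ g ∘ f) ≤ J g`. -/
structure CategoricalInvariant (C : Type u) [Category.{v} C] (N : Type w) [PartialOrder N] where
  obj : C → N
  map : ∀ {X Y : C}, (X ⟶ Y) → N
  map_id : ∀ X : C, map (𝟙 X) = obj X
  map_comp_comp_le : ∀ {X Y W Z : C} (f : X ⟶ Y) (g : Y ⟶ W) (h : W ⟶ Z),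
    map (f ≫ g ≫ h) ≤ map g

/-- The persistent invariant of a persistent object `F`: it sends `[a, b]` to the value of the
transition map `F_a ⟶ F_b`. `NonemptyInterval ℝ` is the poset of closed intervals `[a, b]`,
`a ≤ b`, ordered by inclusion, and `Nᵒᵈ` is `N` with the reversed order. -/
def CategoricalInvariant.persistent {C : Type u} [Category.{v} C] {N : Type w} [PartialOrder N]
    (J : CategoricalInvariant C N) (F : ℝ ⥤ C) : NonemptyInterval ℝ →o Nᵒᵈ where
  toFun I := OrderDual.toDual (J.map (F.map (homOfLE I.fst_le_snd)))
  monotone' I K h := by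
    obtain ⟨h₁, h₂⟩ := NonemptyInterval.le_def.1 h
    have := J.map_comp_comp_le (F.map (homOfLE h₁)) (F.map (homOfLE I.fst_le_snd))
      (F.map (homOfLE h₂))
    rw [← F.map_comp, ← F.map_comp] at this
    exact this

/-! ### Erosion distance -/

/-- The interval `[a - ε, b + ε]`. -/
def NonemptyInterval.thicken (I : NonemptyInterval ℝ) (ε : ℝ≥0) : NonemptyInterval ℝ where
  fst := I.fst - ε
  snd := I.snd + ε
  fst_le_snd := by
    have := I.fst_le_snd
    have := ε.coe_nonneg
    linarith

def IsEroded {N : Type w} [PartialOrder N] (ε : ℝ≥0) (J₁ J₂ : NonemptyInterval ℝ →o Nᵒᵈ) : Prop :=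
  ∀ I : NonemptyInterval ℝ,
    OrderDual.ofDual (J₂ (I.thicken ε)) ≤ OrderDual.ofDual (J₁ I) ∧
    OrderDual.ofDual (J₁ (I.thicken ε)) ≤ OrderDual.ofDual (J₂ I)

/-- The erosion distance; it is `∞` if there is no `ε` as required. -/
noncomputable def erosionDist {N : Type w} [PartialOrder N]
    (J₁ J₂ : NonemptyInterval ℝ →o Nᵒᵈ) : ℝ≥0∞ :=
  ⨅ (ε : ℝ≥0) (_ : IsEroded ε J₁ J₂), (ε : ℝ≥0∞)

/-! ### Interleaving distance -/

/-- The shifted persistent object `t ↦ F_{t + ε}`. -/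
abbrev persistentShift {C : Type u} [Category.{v} C] (ε : ℝ≥0) (F : ℝ ⥤ C) : ℝ ⥤ C where
  obj t := F.obj (t + ε)
  map f := F.map (homOfLE (add_le_add_left (leOfHom f) _))
  map_id t := F.map_id _
  map_comp f g := by rw [← F.map_comp]; rfl

theorem le_add_add_nnreal (t : ℝ) (ε : ℝ≥0) : t ≤ t + ε + ε := by
  have := ε.coe_nonneg
  linarith

def IsInterleaved {C : Type u} [Category.{v} C] (ε : ℝ≥0) (F G : ℝ ⥤ C) : Prop :=
  ∃ (φ : F ⟶ persistentShift ε G) (ψ : G ⟶ persistentShift ε F), ∀ t : ℝ,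
    ((φ.app t : F.obj t ⟶ G.obj (t + ε)) ≫
      (ψ.app (t + ε) : G.obj (t + ε) ⟶ F.obj (t + ε + ε)) =
        F.map (homOfLE (le_add_add_nnreal t ε))) ∧
    ((ψ.app t : G.obj t ⟶ F.obj (t + ε)) ≫
      (φ.app (t + ε) : F.obj (t + ε) ⟶ G.obj (t + ε + ε)) =
        G.map (homOfLE (le_add_add_nnreal t ε)))

noncomputable def interleavingDist {C : Type u} [Category.{v} C] (F G : ℝ ⥤ C) : ℝ≥0∞ :=
  ⨅ (ε : ℝ≥0) (_ : IsInterleaved ε F G), (ε : ℝ≥0∞)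

/-! ### Compactly generated weak Hausdorff spaces and weak homotopy equivalences -/

/-- A space is weak Hausdorff if every continuous image of a compact Hausdorff space in it is
closed. -/
def IsWeakHausdorff (X : Type u) [TopologicalSpace X] : Prop :=
  ∀ (K : Type u) [TopologicalSpace K] [CompactSpace K] [T2Space K] (f : K → X),
    Continuous f → IsClosed (Set.range f)

def isCGWH : ObjectProperty TopCat.{u} :=
  fun X => CompactlyGeneratedSpace X ∧ IsWeakHausdorff X

/-- The category of compactly generated weak Hausdorff spaces and continuous maps. -/
abbrev CGWH : Type (u + 1) := isCGWH.{u}.FullSubcategory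

section Homotopy

variable {X : Type u} {Y : Type v} [TopologicalSpace X] [TopologicalSpace Y]

/-- The map on path components induced by a continuous map. -/
def ZerothHomotopy.mapOfContinuous (f : C(X, Y)) : ZerothHomotopy X → ZerothHomotopy Y :=
  Quotient.map f fun _ _ ⟨p⟩ => ⟨p.map f.continuous⟩

/-- Composition of a generalized loop with a continuous map. -/
def GenLoop.mapOfContinuous (n : ℕ) (f : C(X, Y)) (x : X) (p : Ω^ (Fin n) X x) :
    Ω^ (Fin n) Y (f x) :=
  ⟨f.comp p.1, fun y hy => congrArg f (p.2 y hy)⟩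

/-- The map on the `n`-th homotopy groups induced by a continuous map. -/
def HomotopyGroup.mapOfContinuous (n : ℕ) (f : C(X, Y)) (x : X) : π_ n X x → π_ n Y (f x) :=
  Quotient.map (GenLoop.mapOfContinuous n f x) fun _ _ h => h.map fun H => H.compContinuousMap f

/-- A weak homotopy equivalence: a continuous map that induces a bijection on path components and,
for every base point, bijections on all homotopy groups (for `1 ≤ n` the induced maps are group
homomorphisms, so that bijective means isomorphism). -/
structure IsWeakHomotopyEquiv (f : C(X, Y)) : Prop where
  bijective_zerothHomotopy : Function.Bijective (ZerothHomotopy.mapOfContinuous f)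
  bijective_homotopyGroup : ∀ (n : ℕ) (x : X),
    Function.Bijective (HomotopyGroup.mapOfContinuous n f x)

end Homotopy

/-- A morphism of `CGWH` is a weak homotopy equivalence if the underlying continuous map is. -/
def CGWH.IsWeakEquiv {X Y : CGWH.{u}} (f : X ⟶ Y) : Prop :=
  IsWeakHomotopyEquiv f.hom.hom

/-! ### Homotopy interleaving distance -/

/-- Persistent spaces are weakly equivalent if they are connected by a span of natural
transformations that are objectwise weak homotopy equivalences. -/
def WeaklyEquivalent (X Y : ℝ ⥤ CGWH.{u}) : Prop :=
  ∃ (Z : ℝ ⥤ CGWH.{u}) (φ : Z ⟶ X) (ψ : Z ⟶ Y),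
    ∀ t : ℝ, CGWH.IsWeakEquiv (φ.app t) ∧ CGWH.IsWeakEquiv (ψ.app t)

noncomputable def homotopyInterleavingDist (X Y : ℝ ⥤ CGWH.{u}) : ℝ≥0∞ :=
  ⨅ (X' : ℝ ⥤ CGWH.{u}) (Y' : ℝ ⥤ CGWH.{u})
    (_ : WeaklyEquivalent X' X) (_ : WeaklyEquivalent Y' Y), interleavingDist X' Y'

/-! ### Geometric realization of abstract simplicial complexes -/

/-- The closed simplex spanned by a finite vertex set, in barycentric coordinates. -/
def closedSimplex {V : Type u} (s : Finset V) : Set (V → ℝ) :=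
  {p | (∀ v, 0 ≤ p v) ∧ (∀ v, v ∉ s → p v = 0) ∧ ∑ v ∈ s, p v = 1}

theorem isCompact_closedSimplex {V : Type u} (s : Finset V) : IsCompact (closedSimplex s) := by
  have hK : IsCompact (Set.pi Set.univ fun _ : V => Set.Icc (0 : ℝ) 1) :=
    isCompact_univ_pi fun _ => isCompact_Icc
  refine hK.of_isClosed_subset ?_ ?_
  · have h₁ : IsClosed {p : V → ℝ | ∀ v, 0 ≤ p v} := by
      simp only [Set.ofPred_forall]
      exact isClosed_iInter fun v => isClosed_le continuous_const (continuous_apply v)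
    have h₂ : IsClosed {p : V → ℝ | ∀ v, v ∉ s → p v = 0} := by
      simp only [Set.ofPred_forall]
      exact isClosed_iInter fun v => isClosed_iInter fun _ =>
        isClosed_eq (continuous_apply v) continuous_const
    have h₃ : IsClosed {p : V → ℝ | ∑ v ∈ s, p v = 1} :=
      isClosed_eq (continuous_finsetSum _ fun v _ => continuous_apply v) continuous_const
    exact h₁.inter (h₂.inter h₃)
  · rintro p ⟨h₀, h₁, h₂⟩ v -
    refine ⟨h₀ v, ?_⟩
    by_cases hv : v ∈ s
    · rw [← h₂]
      exact Finset.single_le_sum (fun i _ => h₀ i) hv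
    · rw [h₁ v hv]
      exact zero_le_one

/-- The points of the geometric realization: the barycentric coordinates of points that lie in the
closed simplex of some face. -/
@[ext]
structure Realization {V : Type u} (K : PreAbstractSimplicialComplex V) where
  weight : V → ℝ
  exists_face : ∃ s ∈ K, weight ∈ closedSimplex s

namespace Realization

variable {V : Type u} {K L : PreAbstractSimplicialComplex V}

/-- The inclusion of the closed simplex of a face. -/
def ofFace (s : {s : Finset V // s ∈ K}) (p : closedSimplex s.1) : Realization K :=
  ⟨p.1, s.1, s.2, p.2⟩

/-- The weak (coherent) topology: a set is open if and only if its trace on every closed simplex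
is open in the Euclidean topology of that simplex. -/
instance : TopologicalSpace (Realization K) :=
  ⨆ s : {s : Finset V // s ∈ K}, TopologicalSpace.coinduced (ofFace s) inferInstance

theorem continuous_iff {Z : Type v} [TopologicalSpace Z] {f : Realization K → Z} :
    Continuous f ↔ ∀ s : {s : Finset V // s ∈ K}, Continuous (f ∘ ofFace s) := by
  rw [continuous_iSup_dom]
  exact forall_congr' fun _ => continuous_coinduced_dom

theorem continuous_ofFace (s : {s : Finset V // s ∈ K}) : Continuous (ofFace s) :=
  continuous_iff.1 continuous_id s

theorem continuous_weight : Continuous (weight : Realization K → V → ℝ) :=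
  continuous_iff.2 fun _ => continuous_subtype_val

instance : T2Space (Realization K) :=
  T2Space.of_injective_continuous (fun _ _ h => Realization.ext h) continuous_weight

theorem isCGWH_of : isCGWH (TopCat.of (Realization K)) := by
  refine ⟨?_, fun T _ _ _ f hf => (isCompact_range hf).isClosed⟩
  refine compactlyGeneratedSpace_of_continuous_maps fun f h => continuous_iff.2 fun s => ?_
  have : CompactSpace (closedSimplex s.1) :=
    isCompact_iff_compactSpace.1 (isCompact_closedSimplex s.1)
  exact h (closedSimplex s.1) (ofFace s) (continuous_ofFace s)

/-- The inclusion of realizations induced by an inclusion of complexes. -/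
def inclusion (h : K ≤ L) : C(Realization K, Realization L) where
  toFun p := ⟨p.weight, let ⟨s, hs, hp⟩ := p.exists_face; ⟨s, h hs, hp⟩⟩
  continuous_toFun := continuous_iff.2 fun s => continuous_ofFace (K := L) ⟨s.1, h s.2⟩

end Realization

/-! ### Vietoris-Rips filtration -/

/-- The Vietoris-Rips complex at scale `t`: its faces are the nonempty finite subsets of diameter
at most `t`. In particular it has no faces if `t < 0`. -/
def vietorisRipsComplex (X : Type u) [PseudoMetricSpace X] (t : ℝ) :
    PreAbstractSimplicialComplex X where
  faces := {s | s.Nonempty ∧ Metric.diam (s : Set X) ≤ t}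
  isRelLowerSet_faces := fun s hs => ⟨hs.1, fun _ hr hr' =>
    ⟨hr', (Metric.diam_mono (Finset.coe_subset.2 hr) s.finite_toSet.isBounded).trans hs.2⟩⟩

theorem vietorisRipsComplex_mono (X : Type u) [PseudoMetricSpace X] {t t' : ℝ} (h : t ≤ t') :
    vietorisRipsComplex X t ≤ vietorisRipsComplex X t' :=
  fun _ hs => ⟨hs.1, hs.2.trans h⟩

/-- The Vietoris-Rips filtration: the geometric realizations of the Vietoris-Rips complexes, with
the inclusions as transition maps. -/
def vietorisRips (X : Type u) [PseudoMetricSpace X] : ℝ ⥤ CGWH.{u} where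
  obj t := ⟨TopCat.of (Realization (vietorisRipsComplex X t)), Realization.isCGWH_of⟩
  map f := ObjectProperty.homMk
    (TopCat.ofHom (Realization.inclusion (vietorisRipsComplex_mono X (leOfHom f))))
  map_id _ := rfl
  map_comp _ _ := rfl

/-! ### Invariance of persistent invariants and stability under interleavings -/

section Stability

variable {C : Type u} [Category.{v} C] {N : Type w} [PartialOrder N]

/-! For the first bound, an ε-interleaving factors `F_{a-ε} ⟶ F_{b+ε}` through `G_a ⟶ G_b`, so the
monotonicity axiom of `J` gives ε-erosion. Since `J` ignores composition with weak equivalences,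
naturality squares show that weakly equivalent persistent spaces have equal persistent invariants.
Hence the bound survives any replacement of `X` and `Y`, and passes to the infimum.

For Vietoris-Rips filtrations, maps `f`, `g` of small distortion between `X` and `Y` induce
simplicial maps, but `g ∘ f` is in general only contiguous, hence homotopic, to the inclusion. No
coherence between these homotopies is needed: `J` is homotopy invariant (`map_eq_of_homotopy`),
because both ends of a cylinder are weak equivalences. So the factorization argument applies one
interval at a time (`map_vietorisRips_thicken_le`), without going through a strict interleaving. -/

theorem IsInterleaved.symm {ε : ℝ≥0} {F G : ℝ ⥤ C} (h : IsInterleaved ε F G) :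
    IsInterleaved ε G F :=
  let ⟨φ, ψ, H⟩ := h
  ⟨ψ, φ, fun t => (H t).symm⟩

theorem IsInterleaved.map_thicken_le (J : CategoricalInvariant C N) {ε : ℝ≥0} {F G : ℝ ⥤ C}
    (h : IsInterleaved ε F G) {a b a' b' : ℝ} (hab : a ≤ b) (ha : a' + ε = a) (hb : b + ε = b')
    (hab' : a' ≤ b') : J.map (F.map (homOfLE hab')) ≤ J.map (G.map (homOfLE hab)) := by
  obtain ⟨φ, ψ, H⟩ := h
  -- The endpoints are tied by equations because `a - ε + ε` is not definitionally `a`; substituting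
  -- them makes the composites below typecheck.
  subst ha hb
  have hε := ε.coe_nonneg
  have key : F.map (homOfLE hab') =
      (φ.app a' : F.obj a' ⟶ G.obj (a' + ε)) ≫ G.map (homOfLE hab) ≫
        (ψ.app b : G.obj b ⟶ F.obj (b + ε)) := by
    -- Naturality moves `ψ` in front of the transition map, next to `φ`, where the interleaving
    -- identity applies.
    have hn : G.map (homOfLE hab) ≫ (ψ.app b : G.obj b ⟶ F.obj (b + ε)) =
        (ψ.app (a' + ε) : G.obj (a' + ε) ⟶ F.obj (a' + ε + ε)) ≫
          F.map (homOfLE (by linarith : a' + ε + ε ≤ b + ε)) :=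
      ψ.naturality (homOfLE hab)
    rw [hn, ← Category.assoc, (H a').1, ← F.map_comp]
    rfl
  rw [key]
  exact J.map_comp_comp_le _ _ _

theorem IsInterleaved.isEroded (J : CategoricalInvariant C N) {ε : ℝ≥0} {F G : ℝ ⥤ C}
    (h : IsInterleaved ε F G) : IsEroded ε (J.persistent F) (J.persistent G) := fun I =>
  ⟨h.symm.map_thicken_le J I.fst_le_snd (sub_add_cancel _ _) rfl (I.thicken ε).fst_le_snd,
    h.map_thicken_le J I.fst_le_snd (sub_add_cancel _ _) rfl (I.thicken ε).fst_le_snd⟩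

theorem IsEroded.erosionDist_le {ε : ℝ≥0} {J₁ J₂ : NonemptyInterval ℝ →o Nᵒᵈ}
    (h : IsEroded ε J₁ J₂) : erosionDist J₁ J₂ ≤ ε :=
  iInf₂_le (f := fun (ε : ℝ≥0) (_ : IsEroded ε J₁ J₂) => (ε : ℝ≥0∞)) ε h

theorem erosionDist_le_interleavingDist (J : CategoricalInvariant C N) (F G : ℝ ⥤ C) :
    erosionDist (J.persistent F) (J.persistent G) ≤ interleavingDist F G :=
  le_iInf₂ fun _ h => (h.isEroded J).erosionDist_le

end Stability

/-- An invariant of spaces is unchanged by composition with weak homotopy equivalences. -/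
def CategoricalInvariant.IsWeaklyInvariant {N : Type w} [PartialOrder N]
    (J : CategoricalInvariant CGWH.{u} N) : Prop :=
  ∀ {X Y Z W : CGWH.{u}} (f : X ⟶ Y) (g : Y ⟶ Z) (h : Z ⟶ W), CGWH.IsWeakEquiv g →
    J.map (f ≫ g) = J.map f ∧ J.map (g ≫ h) = J.map h

namespace CategoricalInvariant.IsWeaklyInvariant

variable {N : Type w} [PartialOrder N] {J : CategoricalInvariant CGWH.{u} N}

theorem persistent_eq_of_natTrans (hJ : J.IsWeaklyInvariant) {Z X : ℝ ⥤ CGWH.{u}} (φ : Z ⟶ X)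
    (hφ : ∀ t, CGWH.IsWeakEquiv (φ.app t)) : J.persistent Z = J.persistent X := by
  ext I
  change J.map _ = J.map _
  -- Both composites of the naturality square have the same value. The identities only fill the
  -- unneeded slot of `hJ`.
  rw [← (hJ (Z.map (homOfLE I.fst_le_snd)) (φ.app I.snd) (𝟙 _) (hφ _)).1, φ.naturality]
  exact (hJ (𝟙 _) (φ.app I.fst) _ (hφ _)).2

theorem persistent_eq (hJ : J.IsWeaklyInvariant) {X Y : ℝ ⥤ CGWH.{u}}
    (h : WeaklyEquivalent X Y) : J.persistent X = J.persistent Y := by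
  obtain ⟨Z, φ, ψ, H⟩ := h
  rw [← hJ.persistent_eq_of_natTrans φ fun t => (H t).1,
    hJ.persistent_eq_of_natTrans ψ fun t => (H t).2]

theorem erosionDist_le_homotopyInterleavingDist (hJ : J.IsWeaklyInvariant)
    (X Y : ℝ ⥤ CGWH.{u}) :
    erosionDist (J.persistent X) (J.persistent Y) ≤ homotopyInterleavingDist X Y :=
  le_iInf₂ fun X' Y' => le_iInf₂ fun hX hY => by
    rw [← hJ.persistent_eq hX, ← hJ.persistent_eq hY]
    exact erosionDist_le_interleavingDist J X' Y'

end CategoricalInvariant.IsWeaklyInvariant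

/-! ### Homotopy invariance -/

section Cylinder

variable {X : Type u} [TopologicalSpace X]

/-- The straight-line homotopy of the unit interval onto a point. -/
def unitInterval.lineTo (c : unitInterval) : C(unitInterval × unitInterval, unitInterval) where
  toFun q := ⟨(1 - (q.1 : ℝ)) * q.2 + q.1 * c,
    convex_Icc (0 : ℝ) 1 q.2.2 c.2 (sub_nonneg.2 q.1.2.2) q.1.2.1 (sub_add_cancel _ _)⟩
  continuous_toFun := by fun_prop

@[simp] theorem unitInterval.lineTo_zero (c s : unitInterval) : lineTo c (0, s) = s :=
  Subtype.ext (by simp [lineTo])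

@[simp] theorem unitInterval.lineTo_one (c s : unitInterval) : lineTo c (1, s) = c :=
  Subtype.ext (by simp [lineTo])

@[simp] theorem unitInterval.lineTo_self (c t : unitInterval) : lineTo c (t, c) = c :=
  Subtype.ext (by simp only [lineTo, ContinuousMap.coe_mk]; ring)

/-- The inclusion of a level of the cylinder. -/
def cylinderLevel (X : Type u) [TopologicalSpace X] (c : unitInterval) :
    C(X, unitInterval × X) where
  toFun x := (c, x)

/-- The homotopy that pushes the cylinder onto a level. -/
def cylinderPush (X : Type u) [TopologicalSpace X] (c : unitInterval) :
    C(unitInterval × (unitInterval × X), unitInterval × X) where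
  toFun q := (unitInterval.lineTo c (q.1, q.2.1), q.2.2)

/-- The projection to `X` is a left inverse, and `cylinderPush` deforms the cylinder onto level `c`.
That level stays fixed pointwise, so loops are deformed relative to their boundary. -/
theorem isWeakHomotopyEquiv_cylinderLevel (c : unitInterval) :
    IsWeakHomotopyEquiv (cylinderLevel X c) where
  bijective_zerothHomotopy := by
    constructor
    · rintro ⟨x⟩ ⟨y⟩ h
      obtain ⟨p⟩ := Quotient.exact h
      exact Quotient.sound ⟨p.map continuous_snd⟩
    · rintro ⟨⟨t, x⟩⟩
      refine ⟨Quotient.mk _ x, Quotient.sound ⟨Path.symm ?_⟩⟩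
      exact
        { toFun := fun s => cylinderPush X c (s, (t, x))
          continuous_toFun := by fun_prop
          source' := by simp [cylinderPush]
          target' := by simp [cylinderPush, cylinderLevel] }
  bijective_homotopyGroup n x := by
    constructor
    · rintro ⟨p⟩ ⟨q⟩ h
      have h' := Quotient.exact h
      exact Quotient.sound (h'.map fun H => H.compContinuousMap ContinuousMap.snd)
    · rintro ⟨p⟩
      refine ⟨Quotient.mk _ ⟨ContinuousMap.snd.comp p.1,
        fun y hy => congrArg Prod.snd (p.2 y hy)⟩, Quotient.sound ?_⟩
      refine ContinuousMap.HomotopicRel.symm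
        ⟨⟨⟨⟨fun q => cylinderPush X c (q.1, p.1 q.2), by fun_prop⟩, ?_, ?_⟩, ?_⟩⟩
      · intro y
        simp [cylinderPush]
      · intro y
        simp [cylinderPush, GenLoop.mapOfContinuous, cylinderLevel]
      · intro t y hy
        have h : p y = (c, x) := p.2 y hy
        simp [cylinderPush, h]

end Cylinder

/-- Both maps are the homotopy, as a map on the cylinder, precomposed with an end inclusion, and `J`
ignores these. The cylinder must itself be an object of the category, whence `hX`. -/
theorem CategoricalInvariant.IsWeaklyInvariant.map_eq_of_homotopy {N : Type w} [PartialOrder N]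
    {J : CategoricalInvariant CGWH.{u} N} (hJ : J.IsWeaklyInvariant) {X Y : CGWH.{u}}
    (hX : isCGWH (TopCat.of (unitInterval × X.obj))) {f g : X ⟶ Y}
    (H : ContinuousMap.Homotopy f.hom.hom g.hom.hom) : J.map f = J.map g := by
  let Cyl : CGWH.{u} := ⟨TopCat.of (unitInterval × X.obj), hX⟩
  let i (c : unitInterval) : X ⟶ Cyl := ObjectProperty.homMk (TopCat.ofHom (cylinderLevel X.obj c))
  let h : Cyl ⟶ Y := ObjectProperty.homMk (TopCat.ofHom H.toContinuousMap)
  have hi (c : unitInterval) : J.map (i c ≫ h) = J.map h :=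
    (hJ (𝟙 _) (i c) h (isWeakHomotopyEquiv_cylinderLevel c)).2
  have h₀ : i 0 ≫ h = f := by
    ext x
    exact H.apply_zero x
  have h₁ : i 1 ≫ h = g := by
    ext x
    exact H.apply_one x
  rw [← h₀, ← h₁, hi, hi]

/-! ### Simplicial maps and contiguity -/

section Pushforward

variable {V : Type u} {W : Type v}

/-- The barycentric coordinates of the image of a point under the affine extension of a map of
vertices. -/
noncomputable def pushWeight (f : V → W) (s : Finset V) (p : V → ℝ) : W → ℝ :=
  ⇑(∑ x ∈ s, Finsupp.single (f x) (p x))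

theorem continuous_pushWeight (f : V → W) (s : Finset V) : Continuous (pushWeight f s) := by
  classical
  refine continuous_pi fun y => ?_
  simp only [pushWeight, Finsupp.finsetSum_apply, Finsupp.single_apply]
  refine continuous_finsetSum _ fun x _ => ?_
  split_ifs <;> fun_prop

theorem pushWeight_mem_closedSimplex {f : V → W} {s : Finset V} {t : Finset W}
    (hf : ∀ x ∈ s, f x ∈ t) {p : V → ℝ} (hp : p ∈ closedSimplex s) :
    pushWeight f s p ∈ closedSimplex t := by
  classical
  have h (y : W) : pushWeight f s p y = ∑ x ∈ s, if f x = y then p x else 0 := by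
    simp only [pushWeight, Finsupp.finsetSum_apply, Finsupp.single_apply]
  simp only [closedSimplex, Set.mem_ofPred_eq, h]
  refine ⟨fun y => Finset.sum_nonneg fun x _ => ?_, fun y hy => Finset.sum_eq_zero fun x hx => ?_,
    ?_⟩
  · split_ifs
    exacts [hp.1 x, le_rfl]
  · rw [if_neg]
    rintro rfl
    exact hy (hf x hx)
  · rw [Finset.sum_comm, ← hp.2.2]
    exact Finset.sum_congr rfl fun x hx => by simp [hf x hx]

theorem convex_closedSimplex (s : Finset V) : Convex ℝ (closedSimplex s) := by
  rintro p ⟨hp₀, hp₁, hp₂⟩ q ⟨hq₀, hq₁, hq₂⟩ a b ha hb hab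
  refine ⟨fun v => ?_, fun v hv => ?_, ?_⟩
  · exact add_nonneg (mul_nonneg ha (hp₀ v)) (mul_nonneg hb (hq₀ v))
  · simp [hp₁ v hv, hq₁ v hv]
  · simp [Finset.sum_add_distrib, ← Finset.mul_sum, hp₂, hq₂, hab]

end Pushforward

namespace Realization

section Product

variable {V : Type u} {K : PreAbstractSimplicialComplex V}

/-- The cylinder over a realization carries the topology coherent with the cylinders over the
closed simplices. -/
theorem continuous_cylinder_of {Z : Type v} [TopologicalSpace Z]
    {F : unitInterval × Realization K → Z}
    (hF : ∀ s : {s : Finset V // s ∈ K},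
      Continuous fun q : unitInterval × closedSimplex s.1 => F (q.1, ofFace s q.2)) :
    Continuous F := by
  have hline (p : Realization K) : Continuous fun t : unitInterval => F (t, p) := by
    obtain ⟨s, hs, hp⟩ := p.exists_face
    exact (hF ⟨s, hs⟩).comp (Continuous.prodMk continuous_id
      (continuous_const (y := (⟨p.weight, hp⟩ : closedSimplex s))))
  -- Currying reduces continuity to the coherent topology of the realization alone; uncurrying works
  -- since the interval is locally compact.
  let G : Realization K → C(unitInterval, Z) := fun p => ⟨fun t => F (t, p), hline p⟩
  have hG : Continuous G := continuous_iff.2 fun s =>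
    ContinuousMap.continuous_of_continuous_uncurry _ ((hF s).comp continuous_swap)
  exact (ContinuousMap.continuous_uncurry_of_continuous ⟨G, hG⟩).comp continuous_swap

theorem isCGWH_cylinder : isCGWH (TopCat.of (unitInterval × Realization K)) := by
  refine ⟨?_, fun T _ _ _ f hf => (isCompact_range hf).isClosed⟩
  refine compactlyGeneratedSpace_of_continuous_maps fun f h => continuous_cylinder_of fun s => ?_
  have : CompactSpace (closedSimplex s.1) :=
    isCompact_iff_compactSpace.1 (isCompact_closedSimplex s.1)
  exact h (unitInterval × closedSimplex s.1) (fun q => (q.1, ofFace s q.2))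
    (continuous_fst.prodMk ((continuous_ofFace s).comp continuous_snd))

end Product

variable {V V' V'' : Type u} {K : PreAbstractSimplicialComplex V}
  {L : PreAbstractSimplicialComplex V'} {M : PreAbstractSimplicialComplex V''}

theorem finite_support_weight (p : Realization K) : p.weight.support.Finite := by
  obtain ⟨s, -, hs⟩ := p.exists_face
  exact s.finite_toSet.subset fun v hv => by_contra fun h => hv (hs.2.1 v h)

/-- The barycentric coordinates as a finitely supported function. -/
noncomputable def finsupp (p : Realization K) : V →₀ ℝ :=
  Finsupp.ofSupportFinite p.weight p.finite_support_weight

@[simp] theorem coe_finsupp (p : Realization K) : ⇑p.finsupp = p.weight := rfl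

/-- Links the face-free description, which gives functoriality, with the facewise one, which gives
continuity. -/
theorem mapDomain_finsupp {p : Realization K} {s : Finset V} (hp : p.weight ∈ closedSimplex s)
    (f : V → V') : ⇑(p.finsupp.mapDomain f) = pushWeight f s p.weight := by
  rw [Finsupp.mapDomain, Finsupp.sum_of_support_subset (s := s)]
  · rfl
  · exact fun v hv => by_contra fun h => Finsupp.mem_support_iff.1 hv (hp.2.1 v h)
  · simp

/-- The map of realizations induced by a simplicial map. -/
noncomputable def map (f : V → V') (hf : ∀ s ∈ K, ∃ t ∈ L, ∀ x ∈ s, f x ∈ t) :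
    C(Realization K, Realization L) where
  toFun p := ⟨p.finsupp.mapDomain f, by
    obtain ⟨s, hs, hp⟩ := p.exists_face
    obtain ⟨t, ht, hst⟩ := hf s hs
    exact ⟨t, ht, mapDomain_finsupp hp f ▸ pushWeight_mem_closedSimplex hst hp⟩⟩
  continuous_toFun := continuous_iff.2 fun s => by
    obtain ⟨t, ht, hst⟩ := hf s.1 s.2
    have h : Continuous fun p : closedSimplex s.1 =>
        (⟨pushWeight f s.1 p.1, pushWeight_mem_closedSimplex hst p.2⟩ : closedSimplex t) :=
      ((continuous_pushWeight f s.1).comp continuous_subtype_val).subtype_mk _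
    convert (continuous_ofFace (K := L) ⟨t, ht⟩).comp h using 1
    ext1 p
    exact Realization.ext (mapDomain_finsupp (p := ofFace s p) p.2 f)

theorem finsupp_map (f : V → V') (hf : ∀ s ∈ K, ∃ t ∈ L, ∀ x ∈ s, f x ∈ t) (p : Realization K) :
    (map f hf p).finsupp = p.finsupp.mapDomain f :=
  DFunLike.coe_injective rfl

theorem map_map (f : V → V') (hf : ∀ s ∈ K, ∃ t ∈ L, ∀ x ∈ s, f x ∈ t) (g : V' → V'')
    (hg : ∀ s ∈ L, ∃ t ∈ M, ∀ x ∈ s, g x ∈ t) (hgf : ∀ s ∈ K, ∃ t ∈ M, ∀ x ∈ s, (g ∘ f) x ∈ t)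
    (p : Realization K) : map g hg (map f hf p) = map (g ∘ f) hgf p :=
  Realization.ext <| by
    change ⇑((map f hf p).finsupp.mapDomain g) = ⇑(p.finsupp.mapDomain (g ∘ f))
    rw [finsupp_map, Finsupp.mapDomain_comp]

theorem map_id_eq_inclusion {K L : PreAbstractSimplicialComplex V} (h : K ≤ L) :
    map id (fun s hs => ⟨s, h hs, fun _ hx => hx⟩) = inclusion h := by
  ext1 p
  refine Realization.ext ?_
  change ⇑(p.finsupp.mapDomain id) = p.weight
  rw [Finsupp.mapDomain_id, coe_finsupp]

/-- Contiguous simplicial maps induce homotopic maps of realizations. -/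
noncomputable def homotopyOfContiguous {f g : V → V'}
    (hf : ∀ s ∈ K, ∃ t ∈ L, ∀ x ∈ s, f x ∈ t) (hg : ∀ s ∈ K, ∃ t ∈ L, ∀ x ∈ s, g x ∈ t)
    (hfg : ∀ s ∈ K, ∃ t ∈ L, ∀ x ∈ s, f x ∈ t ∧ g x ∈ t) :
    ContinuousMap.Homotopy (map f hf) (map g hg) where
  toFun q := ⟨(1 - (q.1 : ℝ)) • ⇑(q.2.finsupp.mapDomain f) +
      (q.1 : ℝ) • ⇑(q.2.finsupp.mapDomain g), by
    obtain ⟨s, hs, hp⟩ := q.2.exists_face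
    -- Both images lie in the one simplex `t`, so convexity keeps the segment between them inside
    -- it.
    obtain ⟨t, ht, hst⟩ := hfg s hs
    rw [mapDomain_finsupp hp, mapDomain_finsupp hp]
    exact ⟨t, ht, convex_closedSimplex t
      (pushWeight_mem_closedSimplex (fun x hx => (hst x hx).1) hp)
      (pushWeight_mem_closedSimplex (fun x hx => (hst x hx).2) hp)
      (sub_nonneg.2 q.1.2.2) q.1.2.1 (sub_add_cancel _ _)⟩⟩
  continuous_toFun := continuous_cylinder_of fun s => by
    obtain ⟨t, ht, hst⟩ := hfg s.1 s.2
    have hcf := continuous_pushWeight f s.1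
    have hcg := continuous_pushWeight g s.1
    have h : Continuous fun q : unitInterval × closedSimplex s.1 =>
        (⟨(1 - (q.1 : ℝ)) • pushWeight f s.1 q.2.1 + (q.1 : ℝ) • pushWeight g s.1 q.2.1,
          convex_closedSimplex t
            (pushWeight_mem_closedSimplex (fun x hx => (hst x hx).1) q.2.2)
            (pushWeight_mem_closedSimplex (fun x hx => (hst x hx).2) q.2.2)
            (sub_nonneg.2 q.1.2.2) q.1.2.1 (sub_add_cancel _ _)⟩ : closedSimplex t) := by
      refine Continuous.subtype_mk ?_ _
      fun_prop
    convert (continuous_ofFace (K := L) ⟨t, ht⟩).comp h using 1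
    ext1 q
    refine Realization.ext ?_
    simp only [mapDomain_finsupp (p := ofFace s q.2) q.2.2]
    rfl
  map_zero_left p := Realization.ext (by simp [map])
  map_one_left p := Realization.ext (by simp [map])

end Realization

/-! ### Stability of the Vietoris-Rips filtration -/

theorem mem_vietorisRipsComplex_iff {X : Type u} [PseudoMetricSpace X] {t : ℝ} {s : Finset X} :
    s ∈ vietorisRipsComplex X t ↔ s.Nonempty ∧ ∀ x ∈ s, ∀ y ∈ s, dist x y ≤ t := by
  constructor
  · rintro ⟨hs, hd⟩
    exact ⟨hs, fun x hx y hy =>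
      (Metric.dist_le_diam_of_mem s.finite_toSet.isBounded hx hy).trans hd⟩
  · rintro ⟨⟨x, hx⟩, hd⟩
    refine ⟨⟨x, hx⟩, Metric.diam_le_of_forall_dist_le ?_ hd⟩
    simpa using hd x hx x hx

/-- The face is `f(s) ∪ g(s)`. With `f = g` this says that `f` is simplicial; in general it is
contiguity. -/
theorem exists_vietorisRips_face_of_dist_le {X Y : Type u} [PseudoMetricSpace X]
    [PseudoMetricSpace Y] {f g : X → Y} {t t' : ℝ}
    (hff : ∀ x y, dist x y ≤ t → dist (f x) (f y) ≤ t')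
    (hfg : ∀ x y, dist x y ≤ t → dist (f x) (g y) ≤ t')
    (hgg : ∀ x y, dist x y ≤ t → dist (g x) (g y) ≤ t')
    (s : Finset X) (hs : s ∈ vietorisRipsComplex X t) :
    ∃ r ∈ vietorisRipsComplex Y t', ∀ x ∈ s, f x ∈ r ∧ g x ∈ r := by
  classical
  obtain ⟨⟨x, hx⟩, hd⟩ := mem_vietorisRipsComplex_iff.1 hs
  refine ⟨s.image f ∪ s.image g, mem_vietorisRipsComplex_iff.2
    ⟨⟨f x, by simp only [Finset.mem_union, Finset.mem_image]; exact .inl ⟨x, hx, rfl⟩⟩, ?_⟩,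
    fun y hy => by
      simp only [Finset.mem_union, Finset.mem_image]
      exact ⟨.inl ⟨y, hy, rfl⟩, .inr ⟨y, hy, rfl⟩⟩⟩
  simp only [Finset.mem_union, Finset.mem_image]
  rintro _ (⟨y, hy, rfl⟩ | ⟨y, hy, rfl⟩) _ (⟨z, hz, rfl⟩ | ⟨z, hz, rfl⟩)
  · exact hff y z (hd y hy z hz)
  · exact hfg y z (hd y hy z hz)
  · rw [dist_comm]
    exact hfg z y (hd z hz y hy)
  · exact hgg y z (hd y hy z hz)

section VietorisRips

variable {X Y : Type u} [PseudoMetricSpace X] [PseudoMetricSpace Y] {N : Type w} [PartialOrder N]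
  {J : CategoricalInvariant CGWH.{u} N}

theorem CategoricalInvariant.IsWeaklyInvariant.map_vietorisRips_thicken_le
    (hJ : J.IsWeaklyInvariant) {f : X → Y} {g : Y → X} {ε : ℝ≥0}
    (hf : ∀ x x', dist (f x) (f x') ≤ dist x x' + ε)
    (hg : ∀ y y', dist (g y) (g y') ≤ dist y y' + ε)
    (hfg : ∀ x y, dist x (g y) ≤ dist (f x) y + ε)
    (I : NonemptyInterval ℝ) :
    J.map ((vietorisRips X).map (homOfLE (I.thicken ε).fst_le_snd)) ≤
      J.map ((vietorisRips Y).map (homOfLE I.fst_le_snd)) := by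
  have hε := ε.coe_nonneg
  have hI := I.fst_le_snd
  have hfst : (I.thicken ε).fst = I.fst - ε := rfl
  have hsnd : (I.thicken ε).snd = I.snd + ε := rfl
  have hf' (s) (hs : s ∈ vietorisRipsComplex X (I.thicken ε).fst) :
      ∃ r ∈ vietorisRipsComplex Y I.fst, ∀ x ∈ s, f x ∈ r := by
    have h (x x') (hx : dist x x' ≤ (I.thicken ε).fst) : dist (f x) (f x') ≤ I.fst := by
      linarith [hf x x']
    obtain ⟨r, hr, hsr⟩ := exists_vietorisRips_face_of_dist_le h h h s hs
    exact ⟨r, hr, fun x hx => (hsr x hx).1⟩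
  have hg' (s) (hs : s ∈ vietorisRipsComplex Y I.snd) :
      ∃ r ∈ vietorisRipsComplex X (I.thicken ε).snd, ∀ x ∈ s, g x ∈ r := by
    have h (y y') (hy : dist y y' ≤ I.snd) : dist (g y) (g y') ≤ (I.thicken ε).snd := by
      linarith [hg y y']
    obtain ⟨r, hr, hsr⟩ := exists_vietorisRips_face_of_dist_le h h h s hs
    exact ⟨r, hr, fun x hx => (hsr x hx).1⟩
  -- Passing from `x'` to `g (f x')` costs at most `2ε`, and `(a - ε) + 2ε ≤ b + ε`: this is exactly
  -- the room that thickening provides.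
  have hcont (s) (hs : s ∈ vietorisRipsComplex X (I.thicken ε).fst) :
      ∃ r ∈ vietorisRipsComplex X (I.thicken ε).snd, ∀ x ∈ s, id x ∈ r ∧ (g ∘ f) x ∈ r := by
    refine exists_vietorisRips_face_of_dist_le (fun x x' hx => ?_) (fun x x' hx => ?_)
      (fun x x' hx => ?_) s hs
    · simp only [id]
      linarith
    · simp only [id, Function.comp]
      linarith [hfg x (f x'), hf x x']
    · simp only [Function.comp]
      linarith [hg (f x) (f x'), hf x x']
  have hle := vietorisRipsComplex_mono X (I.thicken ε).fst_le_snd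
  have hgf (s) (hs : s ∈ vietorisRipsComplex X (I.thicken ε).fst) :
      ∃ r ∈ vietorisRipsComplex X (I.thicken ε).snd, ∀ x ∈ s, (g ∘ f) x ∈ r :=
    let ⟨r, hr, hsr⟩ := hcont s hs
    ⟨r, hr, fun x hx => (hsr x hx).2⟩
  let F : (vietorisRips X).obj (I.thicken ε).fst ⟶ (vietorisRips Y).obj I.fst :=
    ObjectProperty.homMk (TopCat.ofHom (Realization.map f hf'))
  let G : (vietorisRips Y).obj I.snd ⟶ (vietorisRips X).obj (I.thicken ε).snd :=
    ObjectProperty.homMk (TopCat.ofHom (Realization.map g hg'))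
  have hcomp : (F ≫ (vietorisRips Y).map (homOfLE I.fst_le_snd) ≫ G).hom.hom =
      Realization.map (g ∘ f) hgf := by
    ext1 p
    -- The inclusion in the middle is absorbed by regarding `f` as simplicial into the larger
    -- complex of `Y`.
    exact Realization.map_map (L := vietorisRipsComplex Y I.snd) f
      (fun s hs => let ⟨r, hr, hsr⟩ := hf' s hs
        ⟨r, vietorisRipsComplex_mono Y I.fst_le_snd hr, hsr⟩) g hg' hgf p
  have H : ContinuousMap.Homotopy
      ((vietorisRips X).map (homOfLE (I.thicken ε).fst_le_snd)).hom.hom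
      (F ≫ (vietorisRips Y).map (homOfLE I.fst_le_snd) ≫ G).hom.hom := by
    rw [hcomp]
    exact (Realization.homotopyOfContiguous _ hgf hcont).cast
      (Realization.map_id_eq_inclusion hle) rfl
  rw [hJ.map_eq_of_homotopy Realization.isCGWH_cylinder H]
  exact J.map_comp_comp_le _ _ _

theorem CategoricalInvariant.IsWeaklyInvariant.isEroded_vietorisRips
    (hJ : J.IsWeaklyInvariant) {f : X → Y} {g : Y → X} {ε : ℝ≥0}
    (hf : ∀ x x', dist (f x) (f x') ≤ dist x x' + ε)
    (hg : ∀ y y', dist (g y) (g y') ≤ dist y y' + ε)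
    (hfg : ∀ x y, dist x (g y) ≤ dist (f x) y + ε)
    (hgf : ∀ x y, dist (f x) y ≤ dist x (g y) + ε) :
    IsEroded ε (J.persistent (vietorisRips X)) (J.persistent (vietorisRips Y)) := fun I =>
  ⟨hJ.map_vietorisRips_thicken_le hg hf
      (fun y x => by rw [dist_comm y, dist_comm (g y)]; exact hgf x y) I,
    hJ.map_vietorisRips_thicken_le hf hg hfg I⟩

end VietorisRips

/-- In optimal isometric embeddings each point has a partner at distance less than `r`. Each
estimate replaces two points by partners, which gives the constant `2 * r`. -/
theorem GromovHausdorff.exists_maps_of_ghDist_lt {X : Type u} {Y : Type v} [MetricSpace X]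
    [CompactSpace X] [Nonempty X] [MetricSpace Y] [CompactSpace Y] [Nonempty Y] {r : ℝ}
    (hr : ghDist X Y < r) : ∃ (f : X → Y) (g : Y → X),
      (∀ x x', dist (f x) (f x') ≤ dist x x' + 2 * r) ∧
      (∀ y y', dist (g y) (g y') ≤ dist y y' + 2 * r) ∧
      (∀ x y, dist x (g y) ≤ dist (f x) y + 2 * r) ∧
      (∀ x y, dist (f x) y ≤ dist x (g y) + 2 * r) := by
  obtain ⟨Φ, Ψ, hΦ, hΨ, h⟩ := ghDist_eq_hausdorffDist X Y
  rw [h] at hr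
  have hfin : Metric.hausdorffEDist (Set.range Φ) (Set.range Ψ) ≠ ⊤ :=
    Metric.hausdorffEDist_ne_top_of_nonempty_of_bounded (Set.range_nonempty _)
      (Set.range_nonempty _) (isCompact_range hΦ.continuous).isBounded
      (isCompact_range hΨ.continuous).isBounded
  have hf (x : X) : ∃ y, dist (Φ x) (Ψ y) < r := by
    obtain ⟨_, ⟨y, rfl⟩, hy⟩ :=
      Metric.exists_dist_lt_of_hausdorffDist_lt (Set.mem_range_self x) hr hfin
    exact ⟨y, hy⟩
  have hg (y : Y) : ∃ x, dist (Φ x) (Ψ y) < r := by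
    obtain ⟨_, ⟨x, rfl⟩, hx⟩ :=
      Metric.exists_dist_lt_of_hausdorffDist_lt' (Set.mem_range_self y) hr hfin
    exact ⟨x, hx⟩
  choose f hf using hf
  choose g hg using hg
  refine ⟨f, g, fun x x' => ?_, fun y y' => ?_, fun x y => ?_, fun x y => ?_⟩
  · rw [← hΨ.dist_eq, ← hΦ.dist_eq x]
    have := dist_triangle4 (Ψ (f x)) (Φ x) (Φ x') (Ψ (f x'))
    rw [dist_comm (Ψ (f x)) (Φ x)] at this
    linarith [hf x, hf x']
  · rw [← hΨ.dist_eq y, ← hΦ.dist_eq]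
    have := dist_triangle4 (Φ (g y)) (Ψ y) (Ψ y') (Φ (g y'))
    rw [dist_comm (Ψ y') (Φ (g y'))] at this
    linarith [hg y, hg y']
  · rw [← hΨ.dist_eq, ← hΦ.dist_eq]
    have := dist_triangle4 (Φ x) (Ψ (f x)) (Ψ y) (Φ (g y))
    rw [dist_comm (Ψ y) (Φ (g y))] at this
    linarith [hf x, hg y]
  · rw [← hΨ.dist_eq, ← hΦ.dist_eq]
    have := dist_triangle4 (Ψ (f x)) (Φ x) (Φ (g y)) (Ψ y)
    rw [dist_comm (Ψ (f x)) (Φ x)] at this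
    linarith [hf x, hg y]

theorem CategoricalInvariant.IsWeaklyInvariant.erosionDist_vietorisRips_le
    {N : Type w} [PartialOrder N] {J : CategoricalInvariant CGWH.{u} N}
    (hJ : J.IsWeaklyInvariant) (X Y : Type u) [MetricSpace X] [CompactSpace X] [Nonempty X]
    [MetricSpace Y] [CompactSpace Y] [Nonempty Y] :
    erosionDist (J.persistent (vietorisRips X)) (J.persistent (vietorisRips Y)) ≤
      2 * ENNReal.ofReal (GromovHausdorff.ghDist X Y) := by
  have h₀ : 0 ≤ GromovHausdorff.ghDist X Y := dist_nonneg
  -- Partners need a radius strictly above the Gromov–Hausdorff distance, so a slack `δ` is added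
  -- and then removed in the limit.
  rw [mul_comm, ← ENNReal.div_le_iff two_ne_zero ENNReal.ofNat_ne_top]
  refine ENNReal.le_of_forall_pos_le_add fun δ hδ _ => ?_
  rw [ENNReal.div_le_iff two_ne_zero ENNReal.ofNat_ne_top, mul_comm]
  obtain ⟨f, g, hf, hg, hfg, hgf⟩ := GromovHausdorff.exists_maps_of_ghDist_lt
    (lt_add_of_pos_right (GromovHausdorff.ghDist X Y) (NNReal.coe_pos.2 hδ))
  have hε : ((2 * (Real.toNNReal (GromovHausdorff.ghDist X Y) + δ) : ℝ≥0) : ℝ) =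
      2 * (GromovHausdorff.ghDist X Y + δ) := by
    simp [Real.coe_toNNReal _ h₀]
  rw [← hε] at hf hg hfg hgf
  refine (hJ.isEroded_vietorisRips hf hg hfg hgf).erosionDist_le.trans_eq ?_
  push_cast
  rfl

theorem theorem2 {N : Type w} [PartialOrder N] (J : CategoricalInvariant CGWH.{u} N)
    (hJ : ∀ {X Y Z W : CGWH.{u}} (f : X ⟶ Y) (g : Y ⟶ Z) (h : Z ⟶ W), CGWH.IsWeakEquiv g →
      J.map (f ≫ g) = J.map f ∧ J.map (g ≫ h) = J.map h) :
    (∀ X Y : ℝ ⥤ CGWH.{u},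
      erosionDist (J.persistent X) (J.persistent Y) ≤ homotopyInterleavingDist X Y) ∧
    (∀ (X Y : Type u) [MetricSpace X] [CompactSpace X] [Nonempty X]
      [MetricSpace Y] [CompactSpace Y] [Nonempty Y],
      erosionDist (J.persistent (vietorisRips X)) (J.persistent (vietorisRips Y)) ≤
        2 * ENNReal.ofReal (GromovHausdorff.ghDist X Y)) := by
  exact ⟨fun X Y => CategoricalInvariant.IsWeaklyInvariant.erosionDist_le_homotopyInterleavingDist hJ X Y,
    fun X Y => CategoricalInvariant.IsWeaklyInvariant.erosionDist_vietorisRips_le hJ X Y⟩
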